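/- For integers $n \ge r \ge 1$ and a real $b \ge 0$ let $$\mathbb{K}(n,r,b)=\{U\in\mathbb{R}^{n\times r}: U^\top U=I_r,\ \|U\|_{2,\infty}\le b\},\qquad \|U\|_{2,\infty}=\max_{1\le i\le n}\|U_{i,\cdot}\|_2,$$ and let $d_{2,\infty}(U,V)=\min_{\Gamma\in\mathbb{O}_r}\|V-U\Gamma\|_{2,\infty}$, where $\mathbb{O}_r$ is the group of $r\times r$ orthogonal matrices. For a set $K$ with a semi-metric $\rho$ and $\delta>0$, let $\mathcal{M}(K,\rho,\delta)$ be the $\delta$-packing number, that is, the largest cardinality of a subset of $K$ any two distinct points $x,y$ of which satisfy $\rho(x,y)>\delta$. There are universal constants $c_0>0$, $c>0$ and $N\in\mathbb{N}$ such that the following holds for all integers $n\ge N$ and $1\le r\le n$ and all real $\mu$ and $\delta>0$. If $$\frac{n}{\mu}\ge\max\{4,r\},\qquad \mu\ge 12\log(12n),\qquad \frac{c_0^2\,r}{8e^2 n}\le\delta^2\le\frac{c_0^2\,\mu r}{96e^2\, n\log(12n/\mu)},$$ then $$\log\mathcal{M}\bigl(\mathbb{K}(n,r,\sqrt{\mu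 r/n}),\,d_{2,\infty},\,\delta\bigr)\ \ge\ c\,\frac{r^2}{\delta^2}.$$ -/

import Mathlib

noncomputable section

/-- The norm `‖M‖_{2,∞}`: the largest Euclidean norm of a row of `M`. -/
def twoInftyNorm {n r : ℕ} (M : Matrix (Fin n) (Fin r) ℝ) : ℝ :=
  ⨆ i : Fin n, ‖(WithLp.toLp 2 (M i) : EuclideanSpace ℝ (Fin r))‖

/-- The distance `d_{2,∞}(U, V) = min_Γ ‖V - U Γ‖_{2,∞}`, where `Γ` ranges over the (compact)
group of `r × r` orthogonal matrices. -/
def dTwoInfty {n r : ℕ} (U V : Matrix (Fin n) (Fin r) ℝ) : ℝ :=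
  ⨅ Γ : Matrix.orthogonalGroup (Fin r) ℝ, twoInftyNorm (V - U * (Γ : Matrix (Fin r) (Fin r) ℝ))

/-- The set `K(n, r, b)` of `n × r` matrices with orthonormal columns and rows of Euclidean norm
at most `b`. -/
def incoherentFrames (n r : ℕ) (b : ℝ) : Set (Matrix (Fin n) (Fin r) ℝ) :=
  {U | U.transpose * U = 1 ∧ twoInftyNorm U ≤ b}

/-- `P` is a `δ`-packing of `K` under `ρ`: a subset of `K` whose distinct points are at
distance greater than `δ`. -/
def IsPacking {X : Type*} (K : Set X) (ρ : X → X → ℝ) (δ : ℝ) (P : Set X) : Prop :=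
  P ⊆ K ∧ P.Pairwise fun x y => δ < ρ x y

/-- The `δ`-packing number `M(K, ρ, δ)`: the largest cardinality of a `δ`-packing of `K`
(infinite if there are arbitrarily large ones). -/
def packingNumber {X : Type*} (K : Set X) (ρ : X → X → ℝ) (δ : ℝ) : ℕ∞ :=
  ⨆ P : {P : Set X // IsPacking K ρ δ P}, P.1.encard

/-- The packing `δ`-entropy `log M(K, ρ, δ)`, with values in the extended reals. -/
def packingEntropy {X : Type*} (K : Set X) (ρ : X → X → ℝ) (δ : ℝ) : EReal :=
  ENNReal.log (packingNumber K ρ δ : ENNReal)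

end

/-! Each matrix of the packing stacks `q` copies of a fixed frame `u₀` over `q` varying orthonormal
`r`-frames in dimension `2r`, scaled by `(2q)^{-1/2}`. The fixed half removes the rotation: if `V -
UΓ` is small, then `u₀ - u₀Γ` forces `Γ` close to `1`, so the varying halves are close too
(`sum_norm_sub_sq_le_twoInftyNorm`). As only `4qr` rows are occupied, Frobenius separation gives
separation in `‖·‖_{2,∞}`.

Separated tuples of frames are counted without measure theory. Columns are added one at a time as
normalised sign vectors in the orthogonal complement of the earlier ones. A Laplace-transform bound
(`exists_spread_frames`) shows that balls contain few of the resulting tuples, so a maximal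
separated set is large (`exists_separated_finset`). Taking `q` of order `1/δ²` gives log-cardinality
of order `q r²`, that is `r²/δ²`. -/

/-! ### Exponential sums over signs -/

theorem exp_neg_sq_add_exp_neg_sq_le (w : ℝ) :
    Real.exp (-(w - 1) ^ 2) + Real.exp (-(w - -1) ^ 2) ≤ Real.exp (3 / 8) := by
  have he : Real.exp (-1) ≤ 3 / 8 := by
    rw [Real.exp_neg, inv_le_comm₀ (Real.exp_pos _) (by norm_num)]
    have := Real.exp_one_gt_d9
    norm_num at this ⊢
    linarith
  have h1 : 3 / 8 + 1 ≤ Real.exp (3 / 8) := Real.add_one_le_exp _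
  -- The nearer sign contributes at most `1`, the farther at most `e⁻¹ ≤ 3/8`.
  rcases le_total 0 w with hw | hw
  · have a : Real.exp (-(w - 1) ^ 2) ≤ 1 := Real.exp_le_one_iff.2 (by nlinarith [sq_nonneg (w - 1)])
    have b : Real.exp (-(w - -1) ^ 2) ≤ Real.exp (-1) := Real.exp_le_exp.2 (by nlinarith)
    linarith
  · have a : Real.exp (-(w - -1) ^ 2) ≤ 1 :=
      Real.exp_le_one_iff.2 (by nlinarith [sq_nonneg (w - -1)])
    have b : Real.exp (-(w - 1) ^ 2) ≤ Real.exp (-1) := Real.exp_le_exp.2 (by nlinarith)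
    linarith

/-- The sign `±1` encoded by a Boolean. -/
def boolSign (b : Bool) : ℝ := if b then 1 else -1

theorem sum_exp_neg_sum_sq_le {D : ℕ} (w : Fin D → ℝ) :
    ∑ ε : Fin D → Bool, Real.exp (-∑ k, (w k - boolSign (ε k)) ^ 2) ≤ Real.exp (3 / 8 * D) := by
  have h := Finset.prod_univ_sum (fun _ : Fin D => (Finset.univ : Finset Bool))
    (fun k b => Real.exp (-(w k - boolSign b) ^ 2))
  rw [Fintype.piFinset_univ] at h
  simp_rw [← Finset.sum_neg_distrib, Real.exp_sum]
  rw [← h]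
  calc _ ≤ ∏ _k : Fin D, Real.exp (3 / 8) := by
        refine Finset.prod_le_prod (fun _ _ => by positivity) fun k _ => ?_
        simpa [boolSign] using exp_neg_sq_add_exp_neg_sq_le (w k)
    _ = _ := by rw [← Real.exp_sum]; simp [mul_comm]

theorem norm_sub_sq_le_two_mul_add {E : Type*} [SeminormedAddCommGroup E] (a b c : E) :
    ‖a - b‖ ^ 2 ≤ 2 * ‖a - c‖ ^ 2 + 2 * ‖b - c‖ ^ 2 := by
  have h := norm_sub_le (a - c) (b - c)
  rw [sub_sub_sub_cancel_right] at h
  nlinarith [norm_nonneg (a - b), sq_nonneg (‖a - c‖ - ‖b - c‖)]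

/-! ### Orthonormal frames built from sign vectors -/

section InnerProduct

variable {E : Type*} [NormedAddCommGroup E] [InnerProductSpace ℝ E]

/-- The vector `D^{-1/2} ∑ ± b k`. -/
noncomputable def signCombination {D : ℕ} (b : Fin D → E) (ε : Fin D → Bool) : E :=
  (√(D : ℝ))⁻¹ • ∑ k, boolSign (ε k) • b k

theorem norm_signCombination {D : ℕ} (hD : D ≠ 0) {b : Fin D → E} (hb : Orthonormal ℝ b)
    (ε : Fin D → Bool) : ‖signCombination b ε‖ = 1 := by
  have h : ‖∑ k, boolSign (ε k) • b k‖ ^ 2 = D := by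
    rw [← real_inner_self_eq_norm_sq, hb.inner_sum]
    have : ∀ b, boolSign b * boolSign b = 1 := by intro b; cases b <;> simp [boolSign]
    simp [this]
  have hD' : (0 : ℝ) < D := by exact_mod_cast Nat.pos_of_ne_zero hD
  rw [signCombination, norm_smul, norm_inv, Real.norm_of_nonneg (Real.sqrt_nonneg _), ← h,
    Real.sqrt_sq (norm_nonneg _), inv_mul_cancel₀]
  intro h0
  rw [h0] at h
  simp at h
  exact hD (by exact_mod_cast h.symm)

/-- By Bessel's inequality, passing to coordinates along `b` only decreases distances, which leaves
the sum over the sign cube. -/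
theorem sum_exp_neg_norm_sub_signCombination_le {D : ℕ} (hD : D ≠ 0) {b : Fin D → E}
    (hb : Orthonormal ℝ b) (v : E) :
    ∑ ε : Fin D → Bool, Real.exp (-(D * ‖v - signCombination b ε‖ ^ 2)) ≤
      Real.exp (3 / 8 * D) := by
  refine le_trans (Finset.sum_le_sum fun ε _ => Real.exp_le_exp.2 (neg_le_neg ?_))
    (sum_exp_neg_sum_sq_le fun k => inner ℝ (b k) (√(D : ℝ) • v))
  have hD' : (0 : ℝ) < D := by exact_mod_cast Nat.pos_of_ne_zero hD
  have h1 : (D : ℝ) * ‖v - signCombination b ε‖ ^ 2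
      = ‖√(D : ℝ) • v - ∑ k, boolSign (ε k) • b k‖ ^ 2 := by
    have : √(D : ℝ) • v - ∑ k, boolSign (ε k) • b k
        = √(D : ℝ) • (v - signCombination b ε) := by
      rw [smul_sub, signCombination, smul_inv_smul₀ (Real.sqrt_pos.2 hD').ne']
    rw [this, norm_smul, mul_pow, Real.norm_of_nonneg (Real.sqrt_nonneg _), Real.sq_sqrt hD'.le]
  rw [h1]
  refine le_trans (le_of_eq ?_) (hb.sum_inner_products_le (s := Finset.univ)
    (x := √(D : ℝ) • v - ∑ k, boolSign (ε k) • b k))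
  refine Finset.sum_congr rfl fun k _ => ?_
  rw [inner_sub_right, hb.inner_right_fintype, Real.norm_eq_abs, sq_abs]

theorem exists_orthonormal_orthogonal [FiniteDimensional ℝ E] {D r : ℕ}
    (h : r + D ≤ Module.finrank ℝ E) (u : Fin r → E) :
    ∃ b : Fin D → E, Orthonormal ℝ b ∧ ∀ k j, inner ℝ (b k) (u j) = 0 := by
  set K := Submodule.span ℝ (Set.range u) with hK
  have h1 := K.finrank_add_finrank_orthogonal
  have h2 : Module.finrank ℝ K ≤ r := by
    simpa [Set.finrank] using finrank_range_le_card (R := ℝ) u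
  have h3 : D ≤ Module.finrank ℝ Kᗮ := by omega
  let B := stdOrthonormalBasis ℝ Kᗮ
  refine ⟨fun k => (B (Fin.castLE h3 k) : E), ?_, fun k j => ?_⟩
  · exact (B.orthonormal.comp_linearIsometry Kᗮ.subtypeₗᵢ).comp _ (Fin.castLE_injective h3)
  · exact Submodule.inner_left_of_mem_orthogonal (Submodule.subset_span (Set.mem_range_self j))
      (B (Fin.castLE h3 k)).2

/-- A family of `2 ^ (D r)` orthonormal `r`-frames that is spread out around every point. -/
theorem exists_spread_frames [FiniteDimensional ℝ E] {D : ℕ} (hD : D ≠ 0) (r : ℕ)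
    (h : r + D ≤ Module.finrank ℝ E) :
    ∃ (ι : Type) (_ : Fintype ι) (u : ι → Fin r → E), Fintype.card ι = 2 ^ (D * r) ∧
      (∀ x, Orthonormal ℝ (u x)) ∧ ∀ v : Fin r → E,
        ∑ x, Real.exp (-∑ j, D * ‖v j - u x j‖ ^ 2) ≤ Real.exp (3 / 8 * (D * r)) := by
  induction r with
  | zero => exact ⟨Unit, inferInstance, fun _ => Fin.elim0, by simp, fun x => by simp, by simp⟩
  | succ r ih =>
    obtain ⟨ι, _, u, hcard, hu, hsum⟩ := ih (by omega)
    -- The basis for the new column depends on the earlier columns, but the bound on its exponential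
    -- sum does not, so the bounds multiply.
    choose b hb hbu using fun x => exists_orthonormal_orthogonal (D := D) (r := r) (by omega) (u x)
    refine ⟨ι × (Fin D → Bool), inferInstance,
      fun x => Matrix.vecCons (signCombination (b x.1) x.2) (u x.1), ?_, fun x => ?_, fun v => ?_⟩
    · simp [hcard, mul_add, pow_add]
    · rw [orthonormal_vecCons_iff]
      refine ⟨norm_signCombination hD (hb _) _, fun i => ?_, hu _⟩
      simp [signCombination, inner_smul_left, sum_inner, hbu]
    · rw [Fintype.sum_prod_type]
      simp only [Fin.sum_univ_succ, Matrix.cons_val_zero, Matrix.cons_val_succ, neg_add,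
        Real.exp_add]
      simp_rw [← Finset.sum_mul]
      calc _ ≤ ∑ x, Real.exp (3 / 8 * D) *
            Real.exp (-∑ j : Fin r, D * ‖v j.succ - u x j‖ ^ 2) := by
            gcongr with x
            exact sum_exp_neg_norm_sub_signCombination_le hD (hb x) _
        _ ≤ Real.exp (3 / 8 * D) * Real.exp (3 / 8 * (D * r)) := by
            rw [← Finset.mul_sum]
            gcongr
            exact hsum fun j => v j.succ
        _ = _ := by rw [← Real.exp_add]; congr 1; push_cast; ring

theorem Orthonormal.sum_norm_sq_sum_smul {r : ℕ} {u : Fin r → E} (hu : Orthonormal ℝ u)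
    (A : Matrix (Fin r) (Fin r) ℝ) :
    ∑ j, ‖∑ k, A k j • u k‖ ^ 2 = ∑ j, ∑ k, A k j ^ 2 := by
  refine Finset.sum_congr rfl fun j _ => ?_
  rw [← real_inner_self_eq_norm_sq, hu.inner_sum]
  simp [sq]

/-- For every orthonormal frame `w`, the Frobenius norm of `w - wA` is that of `1 - A`. The
displacement of `u` by `A` can therefore be read off from `u₀`. -/
theorem Orthonormal.sum_norm_sub_sq_le {r : ℕ} {u u₀ : Fin r → E} (hu : Orthonormal ℝ u)
    (hu₀ : Orthonormal ℝ u₀) (v : Fin r → E) (A : Matrix (Fin r) (Fin r) ℝ) :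
    ∑ j, ‖v j - u j‖ ^ 2 ≤ 2 * ∑ j, ‖v j - ∑ k, A k j • u k‖ ^ 2 +
      2 * ∑ j, ‖u₀ j - ∑ k, A k j • u₀ k‖ ^ 2 := by
  have key : ∀ w : Fin r → E, Orthonormal ℝ w →
      ∑ j, ‖w j - ∑ k, A k j • w k‖ ^ 2 = ∑ j, ∑ k, (1 - A) k j ^ 2 := fun w hw => by
    rw [← hw.sum_norm_sq_sum_smul]
    simp [sub_smul, Finset.sum_sub_distrib, Matrix.one_apply]
  rw [key u₀ hu₀, ← key u hu, Finset.mul_sum, Finset.mul_sum, ← Finset.sum_add_distrib]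
  exact Finset.sum_le_sum fun j _ => norm_sub_sq_le_two_mul_add _ _ _

end InnerProduct

/-! ### Counting separated tuples of frames -/

/-- A maximal separated set is large if all balls are small. -/
theorem exists_separated_finset {X : Type*} [Fintype X] (F : X → X → ℝ)
    (hsymm : ∀ x y, F x y = F y x) {R lam : ℝ} (hF : ∀ x, F x x ≤ R)
    (hsum : ∀ x, ∑ y, Real.exp (-F x y) ≤ lam) :
    ∃ S : Finset X, (S : Set X).Pairwise (fun x y => R < F x y) ∧
      (Fintype.card X : ℝ) ≤ S.card * (Real.exp R * lam) := by
  classical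
  obtain ⟨S, hS, hmax⟩ := Finset.exists_max_image
    (Finset.univ.filter
      fun S : Finset X => (S : Set X).Pairwise fun x y => R < F x y) Finset.card
    ⟨∅, by simp⟩
  simp only [Finset.mem_filter, Finset.mem_univ, true_and] at hS hmax
  refine ⟨S, hS, ?_⟩
  have hcover : (Finset.univ : Finset X) ⊆
      S.biUnion fun x => Finset.univ.filter fun y => F x y ≤ R := by
    intro y _
    by_contra hy
    simp only [Finset.mem_biUnion, Finset.mem_filter, Finset.mem_univ, true_and, not_exists,
      not_and, not_le] at hy
    have hyS : y ∉ S := fun h => absurd (hF y) (not_le.2 (hy y h))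
    have := hmax (insert y S) (by
      rw [Finset.coe_insert]
      exact hS.insert fun x hx _ => ⟨hsymm x y ▸ hy x hx, hy x hx⟩)
    rw [Finset.card_insert_of_notMem hyS] at this
    omega
  -- Chernoff bound: the indicator of `F x y ≤ R` is at most `exp (R - F x y)`.
  have hball : ∀ x, ((Finset.univ.filter fun y => F x y ≤ R).card : ℝ) ≤ Real.exp R * lam := by
    intro x
    calc _ = ∑ y ∈ Finset.univ.filter fun y => F x y ≤ R, (1 : ℝ) := by simp
      _ ≤ ∑ y ∈ Finset.univ.filter fun y => F x y ≤ R, Real.exp R * Real.exp (-F x y) := by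
          refine Finset.sum_le_sum fun y hy => ?_
          rw [← Real.exp_add, Real.one_le_exp_iff]
          have := (Finset.mem_filter.1 hy).2
          linarith
      _ ≤ ∑ y, Real.exp R * Real.exp (-F x y) :=
          Finset.sum_le_sum_of_subset_of_nonneg (Finset.filter_subset _ _)
            fun _ _ _ => by positivity
      _ ≤ _ := by
          rw [← Finset.mul_sum]
          gcongr
          exact hsum x
  calc (Fintype.card X : ℝ) ≤ ∑ x ∈ S, ((Finset.univ.filter fun y => F x y ≤ R).card : ℝ) := by
        exact_mod_cast (Finset.card_le_card hcover).trans Finset.card_biUnion_le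
    _ ≤ ∑ _x ∈ S, Real.exp R * lam := Finset.sum_le_sum fun x _ => hball x
    _ = _ := by simp

/-- Many `q`-tuples of orthonormal `r`-frames in dimension `2 r`, pairwise far apart. -/
theorem exists_separated_frame_tuples (q : ℕ) {r : ℕ} (hr : r ≠ 0) :
    ∃ (ι : Type) (S : Finset ι) (u : ι → Fin q → Fin r → EuclideanSpace ℝ (Fin (2 * r))),
      (∀ x i, Orthonormal ℝ (u x i)) ∧
      (S : Set ι).Pairwise (fun x y => (q * r / 8 : ℝ) < ∑ i, ∑ j, ‖u x i j - u y i j‖ ^ 2) ∧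
      Real.exp (q * r ^ 2 / 8) ≤ S.card := by
  obtain ⟨ι, _, u, hcard, hu, hsum⟩ := exists_spread_frames (E := EuclideanSpace ℝ (Fin (2 * r)))
    hr r (by simp [two_mul])
  have hr' : (0 : ℝ) < r := by exact_mod_cast Nat.pos_of_ne_zero hr
  obtain ⟨S, hS, hSc⟩ := exists_separated_finset (X := Fin q → ι)
    (fun x y => ∑ i, ∑ j, (r : ℝ) * ‖u (x i) j - u (y i) j‖ ^ 2)
    (fun x y => by simp only [norm_sub_rev]) (R := q * r ^ 2 / 8)
    (lam := Real.exp (3 / 8 * (q * r ^ 2))) (fun x => by simp; positivity) (fun x => by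
      have h := Finset.prod_univ_sum (fun _ : Fin q => (Finset.univ : Finset ι))
        (fun i y => Real.exp (-∑ j, (r : ℝ) * ‖u (x i) j - u y j‖ ^ 2))
      rw [Fintype.piFinset_univ] at h
      simp_rw [← Finset.sum_neg_distrib (s := (Finset.univ : Finset (Fin q))), Real.exp_sum]
      rw [← h]
      calc _ ≤ ∏ _i : Fin q, Real.exp (3 / 8 * (r * r)) :=
            Finset.prod_le_prod (fun _ _ => by positivity) fun i _ => hsum _
        _ = _ := by rw [← Real.exp_sum]; congr 1; simp; ring)
  refine ⟨Fin q → ι, S, fun x i => u (x i), fun x i => hu _, fun x hx y hy hxy => ?_, ?_⟩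
  · have h := hS hx hy hxy
    simp_rw [← Finset.mul_sum] at h
    rw [show (q * r ^ 2 / 8 : ℝ) = r * (q * r / 8) by ring] at h
    exact lt_of_mul_lt_mul_left h hr'.le
  · have hc : (Fintype.card (Fin q → ι) : ℝ) = Real.exp (q * r ^ 2 * Real.log 2) := by
      rw [mul_comm, Real.exp_mul, Real.exp_log two_pos]
      have : (q * r ^ 2 : ℝ) = ((r * r * q : ℕ) : ℝ) := by push_cast; ring
      rw [this, Real.rpow_natCast]
      simp [hcard, pow_mul]
    rw [hc, ← Real.exp_add] at hSc
    -- The exponents close because `log 2 - 3/8 ≥ 1/8 + 1/8`.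
    have h2 := Real.log_two_gt_d9
    have hN : (0 : ℝ) ≤ q * r ^ 2 := by positivity
    refine le_of_mul_le_mul_right (le_trans ?_ hSc) (Real.exp_pos _)
    rw [← Real.exp_add, Real.exp_le_exp]
    nlinarith

/-! ### Stacked frames -/

/-- `q` copies of the frame `u₀` on top of the `q` frames `u i`, scaled to have orthonormal columns,
with the rows placed at the positions `e` and zero rows elsewhere. -/
noncomputable def stackedFrame {n q r s : ℕ} (e : (Fin q × Fin s) ⊕ (Fin q × Fin s) → Fin n)
    (u₀ : Fin r → EuclideanSpace ℝ (Fin s)) (u : Fin q → Fin r → EuclideanSpace ℝ (Fin s)) :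
    Matrix (Fin n) (Fin r) ℝ :=
  Matrix.of (Function.extend e
    (fun b j => (√(2 * q : ℝ))⁻¹ * Sum.elim (fun p => u₀ j p.2) (fun p => u p.1 j p.2) b) 0)

section

variable {n q r s : ℕ} {e : (Fin q × Fin s) ⊕ (Fin q × Fin s) → Fin n}
  {u₀ : Fin r → EuclideanSpace ℝ (Fin s)} {u : Fin q → Fin r → EuclideanSpace ℝ (Fin s)}

theorem stackedFrame_apply (he : Function.Injective e) (b : (Fin q × Fin s) ⊕ (Fin q × Fin s))
    (j : Fin r) : stackedFrame e u₀ u (e b) j =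
      (√(2 * q : ℝ))⁻¹ * Sum.elim (fun p => u₀ j p.2) (fun p => u p.1 j p.2) b := by
  simp [stackedFrame, he.extend_apply]

theorem stackedFrame_apply_of_notMem {i : Fin n} (hi : i ∉ Set.range e) (j : Fin r) :
    stackedFrame e u₀ u i j = 0 := by
  simp [stackedFrame, Function.extend_apply' _ _ _ hi]

theorem inv_sqrt_two_mul_sq (q : ℕ) : (√(2 * q : ℝ))⁻¹ ^ 2 = (2 * q : ℝ)⁻¹ := by
  rw [inv_pow, Real.sq_sqrt (by positivity)]

theorem Orthonormal.sum_mul_eq {w : Fin r → EuclideanSpace ℝ (Fin s)} (hw : Orthonormal ℝ w)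
    (j k : Fin r) : ∑ a, w j a * w k a = (1 : Matrix (Fin r) (Fin r) ℝ) j k := by
  have h := orthonormal_iff_ite.1 hw j k
  rw [PiLp.inner_apply] at h
  simpa [Matrix.one_apply, mul_comm] using h

/-- Bessel's inequality for a standard basis vector; this is what makes stacked frames incoherent.
-/
theorem Orthonormal.sum_sq_apply_le {w : Fin r → EuclideanSpace ℝ (Fin s)} (hw : Orthonormal ℝ w)
    (a : Fin s) : ∑ j, w j a ^ 2 ≤ 1 := by
  simpa [EuclideanSpace.inner_single_right] using
    hw.sum_inner_products_le (s := Finset.univ) (x := EuclideanSpace.single a (1 : ℝ))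

theorem transpose_mul_stackedFrame (hq : q ≠ 0) (he : Function.Injective e)
    (h₀ : Orthonormal ℝ u₀) (hu : ∀ i, Orthonormal ℝ (u i)) :
    (stackedFrame e u₀ u).transpose * stackedFrame e u₀ u = 1 := by
  ext j k
  have hq' : (q : ℝ) ≠ 0 := by exact_mod_cast hq
  rw [Matrix.mul_apply, ← Fintype.sum_of_injective e he
    (fun b => ((√(2 * q : ℝ))⁻¹ * Sum.elim (fun p => u₀ j p.2) (fun p => u p.1 j p.2) b) *
      ((√(2 * q : ℝ))⁻¹ * Sum.elim (fun p => u₀ k p.2) (fun p => u p.1 k p.2) b)) _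
    (fun i hi => by simp [stackedFrame_apply_of_notMem hi])
    (fun b => by simp only [Matrix.transpose_apply, stackedFrame_apply he])]
  simp_rw [mul_mul_mul_comm, ← sq, inv_sqrt_two_mul_sq, ← Finset.mul_sum, Fintype.sum_sum_type,
    Fintype.sum_prod_type]
  simp only [Sum.elim_inl, Sum.elim_inr, h₀.sum_mul_eq, (hu _).sum_mul_eq, Finset.sum_const,
    Finset.card_univ, Fintype.card_fin, nsmul_eq_mul]
  field_simp
  ring

theorem twoInftyNorm_stackedFrame_le (he : Function.Injective e)
    (h₀ : Orthonormal ℝ u₀) (hu : ∀ i, Orthonormal ℝ (u i)) :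
    twoInftyNorm (stackedFrame e u₀ u) ≤ √((2 * q : ℝ)⁻¹) := by
  refine Real.iSup_le (fun i => ?_) (Real.sqrt_nonneg _)
  rw [EuclideanSpace.norm_eq]
  refine Real.sqrt_le_sqrt ?_
  by_cases hi : i ∈ Set.range e
  · obtain ⟨b, rfl⟩ := hi
    simp only [stackedFrame_apply he, Real.norm_eq_abs, sq_abs, mul_pow, inv_sqrt_two_mul_sq,
      ← Finset.mul_sum]
    refine mul_le_of_le_one_right (by positivity) ?_
    rcases b with b | b
    · exact h₀.sum_sq_apply_le _
    · exact (hu _).sum_sq_apply_le _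
  · simp only [stackedFrame_apply_of_notMem hi]
    simp

theorem sum_row_sq_le_twoInftyNorm_sq (M : Matrix (Fin n) (Fin r) ℝ) (i : Fin n) :
    ∑ j, M i j ^ 2 ≤ twoInftyNorm M ^ 2 := by
  have h : ‖(WithLp.toLp 2 (M i) : EuclideanSpace ℝ (Fin r))‖ ≤ twoInftyNorm M :=
    le_ciSup (f := fun i => ‖(WithLp.toLp 2 (M i) : EuclideanSpace ℝ (Fin r))‖)
      (Set.finite_range _).bddAbove i
  calc _ = ‖(WithLp.toLp 2 (M i) : EuclideanSpace ℝ (Fin r))‖ ^ 2 := by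
        simp [EuclideanSpace.norm_sq_eq]
    _ ≤ _ := by gcongr

/-- Each varying block is compared with one copy of `u₀`, which is why there are as many copies as
blocks. Orthogonality of `A` plays no role. -/
theorem sum_norm_sub_sq_le_twoInftyNorm (hq : q ≠ 0) (he : Function.Injective e)
    {v : Fin q → Fin r → EuclideanSpace ℝ (Fin s)}
    (h₀ : Orthonormal ℝ u₀) (hu : ∀ i, Orthonormal ℝ (u i)) (A : Matrix (Fin r) (Fin r) ℝ) :
    ∑ i, ∑ j, ‖v i j - u i j‖ ^ 2 ≤
      8 * q ^ 2 * s * twoInftyNorm (stackedFrame e u₀ v - stackedFrame e u₀ u * A) ^ 2 := by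
  set M := stackedFrame e u₀ v - stackedFrame e u₀ u * A with hM
  have hq' : (q : ℝ) ≠ 0 := by exact_mod_cast hq
  have hrow : ∀ b j, M (e b) j = (√(2 * q : ℝ))⁻¹ *
      Sum.elim (fun p => (u₀ j - ∑ k, A k j • u₀ k) p.2)
        (fun p => (v p.1 j - ∑ k, A k j • u p.1 k) p.2) b := by
    intro b j
    rw [hM, Matrix.sub_apply, Matrix.mul_apply]
    simp only [stackedFrame_apply he]
    rcases b with b | b
    all_goals
      simp [mul_sub, Finset.mul_sum, mul_assoc]
      exact Finset.sum_congr rfl fun _ _ => by ring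
  have hcols : ∀ w : EuclideanSpace ℝ (Fin s), ∑ a, w a ^ 2 = ‖w‖ ^ 2 := by
    simp [EuclideanSpace.norm_sq_eq]
  have hsum : ∑ b, ∑ j, M (e b) j ^ 2 = (2 * q : ℝ)⁻¹ *
      (q * ∑ j, ‖u₀ j - ∑ k, A k j • u₀ k‖ ^ 2 +
        ∑ i, ∑ j, ‖v i j - ∑ k, A k j • u i k‖ ^ 2) := by
    simp_rw [hrow, mul_pow, inv_sqrt_two_mul_sq, ← Finset.mul_sum]
    congr 1
    rw [Fintype.sum_sum_type, Fintype.sum_prod_type, Fintype.sum_prod_type]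
    simp only [Sum.elim_inl, Sum.elim_inr]
    congr 1
    · rw [Finset.sum_const, Finset.sum_comm]
      simp only [hcols, Finset.card_univ, Fintype.card_fin, nsmul_eq_mul]
    · refine Finset.sum_congr rfl fun i _ => ?_
      rw [Finset.sum_comm]
      simp only [hcols]
  have hle : ∑ b, ∑ j, M (e b) j ^ 2 ≤ 2 * q * s * twoInftyNorm M ^ 2 := by
    refine (Finset.sum_le_sum fun b _ => sum_row_sq_le_twoInftyNorm_sq M (e b)).trans_eq ?_
    rw [Finset.sum_const, Finset.card_univ, Fintype.card_sum, Fintype.card_prod,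
      Fintype.card_fin, Fintype.card_fin, nsmul_eq_mul]
    push_cast
    ring
  have hblock : ∑ i, ∑ j, ‖v i j - u i j‖ ^ 2 ≤
      2 * (q * ∑ j, ‖u₀ j - ∑ k, A k j • u₀ k‖ ^ 2 +
        ∑ i, ∑ j, ‖v i j - ∑ k, A k j • u i k‖ ^ 2) := by
    refine (Finset.sum_le_sum fun i _ => (hu i).sum_norm_sub_sq_le h₀ (v i) A).trans_eq ?_
    rw [Finset.sum_add_distrib, ← Finset.mul_sum]
    simp
    ring
  rw [hsum, inv_mul_le_iff₀ (by positivity)] at hle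
  linarith

end

/-! ### The packing and the choice of parameters -/

/-- A large packing of the incoherent frames, provided `4 q r` rows are available. -/
theorem exists_packing_incoherentFrames {n q r : ℕ} (hq : q ≠ 0) (hr : r ≠ 0)
    (hn : 4 * q * r ≤ n) {b δ : ℝ} (hb : (2 * q : ℝ)⁻¹ ≤ b ^ 2) (hb₀ : 0 ≤ b)
    (hδ : 128 * q * δ ^ 2 < 1) :
    ∃ P : Set (Matrix (Fin n) (Fin r) ℝ), IsPacking (incoherentFrames n r b) dTwoInfty δ P ∧
      ∃ k : ℕ, P.encard = k ∧ Real.exp (q * r ^ 2 / 8) ≤ k := by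
  obtain ⟨ι, S, u, hu, hS, hSc⟩ := exists_separated_frame_tuples q hr
  have hq' : (0 : ℝ) < q := by exact_mod_cast Nat.pos_of_ne_zero hq
  have hr' : (0 : ℝ) < r := by exact_mod_cast Nat.pos_of_ne_zero hr
  obtain ⟨x₀, -⟩ : S.Nonempty := by
    rw [← Finset.card_pos]
    exact_mod_cast (Real.exp_pos _).trans_le hSc
  set u₀ := u x₀ ⟨0, Nat.pos_of_ne_zero hq⟩
  have h₀ : Orthonormal ℝ u₀ := hu _ _
  obtain ⟨e⟩ : Nonempty ((Fin q × Fin (2 * r)) ⊕ (Fin q × Fin (2 * r)) ↪ Fin n) := by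
    rw [Function.Embedding.nonempty_iff_card_le]
    simp
    linarith
  set U := fun x => stackedFrame e u₀ (u x) with hU
  -- A bound uniform in `A` survives the infimum over `Γ`; `A = 1` also yields injectivity of `U`.
  have hsep : ∀ x ∈ S, ∀ y ∈ S, x ≠ y → ∀ A : Matrix (Fin r) (Fin r) ℝ,
      √(128 * q : ℝ)⁻¹ ≤ twoInftyNorm (U y - U x * A) := by
    intro x hx y hy hxy A
    have h1 := (hS hy hx hxy.symm).trans_le
      (sum_norm_sub_sq_le_twoInftyNorm (v := u y) hq e.injective h₀ (hu x) A)
    set t := twoInftyNorm (U y - U x * A) with ht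
    have ht₀ : 0 ≤ t := Real.iSup_nonneg fun _ => norm_nonneg _
    refine Real.sqrt_le_iff.2 ⟨ht₀, ?_⟩
    rw [inv_le_iff_one_le_mul₀ (by positivity)]
    have h2 : (q * r / 8 : ℝ) * 1 < q * r / 8 * (t ^ 2 * (128 * q)) := by
      refine lt_of_eq_of_lt (mul_one _) (h1.trans_eq ?_)
      push_cast
      ring
    exact (lt_of_mul_lt_mul_left h2 (by positivity)).le
  have hdist : δ < √(128 * q : ℝ)⁻¹ := by
    refine Real.lt_sqrt_of_sq_lt ?_
    rw [← one_div, lt_div_iff₀ (by positivity)]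
    linarith
  have hd : ∀ x ∈ S, ∀ y ∈ S, x ≠ y → δ < dTwoInfty (U x) (U y) := fun x hx y hy hxy =>
    hdist.trans_le (le_ciInf fun Γ => hsep x hx y hy hxy _)
  have hinj : Set.InjOn U S := by
    intro x hx y hy hxy
    by_contra hne
    have h1 := hsep x hx y hy hne 1
    rw [hxy, Matrix.mul_one, sub_self] at h1
    have h2 : twoInftyNorm (0 : Matrix (Fin n) (Fin r) ℝ) ≤ 0 :=
      Real.iSup_le (fun i => by
        rw [show (0 : Matrix (Fin n) (Fin r) ℝ) i = 0 from rfl]; simp) le_rfl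
    have h3 : 0 < √(128 * q : ℝ)⁻¹ := by positivity
    linarith
  refine ⟨U '' S, ⟨?_, ?_⟩, S.card, ?_, hSc⟩
  · rintro _ ⟨x, -, rfl⟩
    refine ⟨transpose_mul_stackedFrame hq e.injective h₀ (hu x),
      (twoInftyNorm_stackedFrame_le e.injective h₀ (hu x)).trans ?_⟩
    exact Real.sqrt_le_iff.2 ⟨hb₀, hb⟩
  · rintro _ ⟨x, hx, rfl⟩ _ ⟨y, hy, rfl⟩ hxy
    exact hd x hx y hy fun h => hxy (h ▸ rfl)
  · rw [hinj.encard_image, Set.encard_coe_eq_coe_finsetCard]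

theorem le_packingEntropy {X : Type*} {K : Set X} {ρ : X → X → ℝ} {δ a : ℝ} {P : Set X}
    (hP : IsPacking K ρ δ P) {k : ℕ} (hk : P.encard = k) (ha : Real.exp a ≤ k) :
    (a : EReal) ≤ packingEntropy K ρ δ := by
  have h1 : (k : ℕ∞) ≤ packingNumber K ρ δ :=
    hk ▸ le_iSup (fun P : {P : Set X // IsPacking K ρ δ P} => P.1.encard) ⟨P, hP⟩
  have h2 : ENNReal.ofReal (Real.exp a) ≤ (packingNumber K ρ δ : ENNReal) := by
    refine (ENNReal.ofReal_le_ofReal ha).trans ?_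
    rw [ENNReal.ofReal_natCast]
    exact_mod_cast h1
  calc (a : EReal) = ENNReal.log (ENNReal.ofReal (Real.exp a)) := by
        rw [ENNReal.log_ofReal_of_pos (Real.exp_pos _), Real.log_exp]
    _ ≤ _ := ENNReal.log_monotone h2

theorem lemma4 :
    ∃ c₀ : ℝ, 0 < c₀ ∧ ∃ c : ℝ, 0 < c ∧ ∃ N : ℕ,
      ∀ n : ℕ, N ≤ n → ∀ r : ℕ, 1 ≤ r → r ≤ n → ∀ μ δ : ℝ,
        max 4 (r : ℝ) ≤ (n : ℝ) / μ →
        12 * Real.log (12 * (n : ℝ)) ≤ μ →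
        0 < δ →
        c₀ ^ 2 * (r : ℝ) / (8 * Real.exp 1 ^ 2 * (n : ℝ)) ≤ δ ^ 2 →
        δ ^ 2 ≤ c₀ ^ 2 * μ * (r : ℝ) /
          (96 * Real.exp 1 ^ 2 * (n : ℝ) * Real.log (12 * (n : ℝ) / μ)) →
        ((c * ((r : ℝ) ^ 2 / δ ^ 2) : ℝ) : EReal) ≤
          packingEntropy (incoherentFrames n r (Real.sqrt (μ * (r : ℝ) / (n : ℝ)))) dTwoInfty δ := by
  refine ⟨1, one_pos, 1 / (512 * Real.exp 1 ^ 2), by positivity, 0, ?_⟩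
  intro n _ r hr hrn μ δ hmax hμ hδ hlow hup
  set e2 := Real.exp 1 ^ 2 with he2
  have he2' : 4 < e2 := by
    have := Real.exp_one_gt_d9
    nlinarith
  have hr' : (1 : ℝ) ≤ r := by exact_mod_cast hr
  have hn' : (1 : ℝ) ≤ n := by exact_mod_cast hr.trans hrn
  have hμ₀ : 0 < μ := (mul_pos (by norm_num) (Real.log_pos (by linarith))).trans_le hμ
  obtain ⟨h4, hrμ⟩ := max_le_iff.1 hmax
  have hL : 1 ≤ Real.log (12 * (n : ℝ) / μ) := by
    rw [Real.le_log_iff_exp_le (by positivity), mul_div_assoc]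
    have := Real.exp_one_lt_d9
    linarith
  -- `m` is the row budget: the lower bound on `δ²` says `m ≤ n`, and the upper one, with the
  -- logarithm bounded below by `1`, gives `12 n/μ ≤ m`.
  set m : ℝ := r / (8 * e2 * δ ^ 2) with hm
  have hmδ : m * (8 * e2 * δ ^ 2) = r := div_mul_cancel₀ _ (by positivity)
  have hmn : m ≤ n := by
    rw [hm, div_le_iff₀ (by positivity)]
    rw [div_le_iff₀ (by positivity)] at hlow
    linarith
  have hmμ : 12 * (n / μ) ≤ m := by
    rw [hm, le_div_iff₀ (by positivity)]
    rw [le_div_iff₀ (by positivity)] at hup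
    have h1 : δ ^ 2 * (96 * e2 * n * 1) ≤ μ * r := by
      refine le_trans ?_ (hup.trans_eq (by ring))
      gcongr
    rw [show 12 * (n / μ) * (8 * e2 * δ ^ 2) = δ ^ 2 * (96 * e2 * n * 1) / μ by ring,
      div_le_iff₀ hμ₀]
    linarith
  have hm1 : 1 ≤ m / (4 * r) := by
    rw [le_div_iff₀ (by positivity)]
    linarith
  -- The largest `q` whose `4qr` rows fit into `m`. Since `q ≥ 1`, rounding loses at most a factor
  -- `2`, so `m ≤ 8qr`.
  set q := ⌊m / (4 * r)⌋₊ with hq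
  have hq1 : 1 ≤ q := Nat.le_floor (by simpa using hm1)
  have hqle : (q : ℝ) * (4 * r) ≤ m := by
    rw [← le_div_iff₀ (by positivity)]
    exact Nat.floor_le (by linarith)
  have hqge : m ≤ q * (8 * r) := by
    have h1 := Nat.lt_floor_add_one (m / (4 * r))
    rw [div_lt_iff₀ (by positivity)] at h1
    have h2 : (1 : ℝ) ≤ q := by exact_mod_cast hq1
    nlinarith
  have hq' : (0 : ℝ) < q := by exact_mod_cast hq1
  obtain ⟨P, hP, k, hk, hcard⟩ := exists_packing_incoherentFrames (n := n) (q := q) (r := r)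
    (b := √(μ * r / n)) (δ := δ) (by omega) (by omega) (by
      have : (4 * q * r : ℝ) ≤ n := by linarith
      exact_mod_cast this) (by
      rw [Real.sq_sqrt (by positivity), inv_le_iff_one_le_mul₀ (by positivity),
        div_mul_eq_mul_div, le_div_iff₀ (by positivity)]
      have h1 : n = μ * (n / μ) := by field_simp
      have h2 : n / μ ≤ r * (2 * q) := by
        have : 0 < n / μ := by positivity
        linarith
      calc (1 * n : ℝ) = μ * (n / μ) := by rw [← h1, one_mul]
        _ ≤ μ * (r * (2 * q)) := by gcongr
        _ = _ := by ring) (Real.sqrt_nonneg _) (by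
      have h1 : (q * (4 * r)) * (8 * e2 * δ ^ 2) ≤ r * 1 := by
        rw [mul_one]
        refine le_trans ?_ hmδ.le
        gcongr
      have h2 : q * 32 * e2 * δ ^ 2 ≤ 1 := by
        refine le_of_mul_le_mul_left (le_trans (le_of_eq ?_) h1) (by linarith : (0 : ℝ) < r)
        ring
      have h3 : 0 < q * δ ^ 2 := by positivity
      nlinarith)
  refine le_packingEntropy hP hk (le_trans (Real.exp_le_exp.2 ?_) hcard)
  have h1 : (r : ℝ) ^ 2 / δ ^ 2 = r * m * (8 * e2) := by
    rw [hm]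
    field_simp
  rw [h1]
  -- The constant `c` is fixed here: `m ≤ 8qr` gives `rm/64 ≤ qr²/8`.
  have h2 : 1 / (512 * e2) * (r * m * (8 * e2)) = r * m / 64 := by
    field_simp
    ring
  rw [h2]
  nlinarith
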